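/- Let $\mathbb{Q}_0=\mathbb{Q}/\mathbb{Z}$ be the rational circle with its usual counter-clockwise circular order, and let $G=\mathrm{Aut}(\mathbb{Q}_0)$ be the group of all permutations of $\mathbb{Q}_0$ that preserve the circular order, with the topology $\tau_0$ of pointwise convergence inherited from the product $\mathbb{Q}_0^{\mathbb{Q}_0}$, where $\mathbb{Q}_0$ is discrete. Let $\mathrm{Aut}(\mathbb{Q},\le)$ be the group of order automorphisms of $\mathbb{Q}$, with the pointwise topology coming from discrete $\mathbb{Q}$. For a topological group $(G,\gamma)$, denote by $\mathcal{T}_{\downarrow}(G)$ the set of all Hausdorff group topologies $\sigma\subseteq\gamma$ on $G$. Then $(G,\tau_0)$ is a Polish topological group, the group $\mathrm{Aut}(\mathbb{Q},\le)$ is extremely amenable (every continuous action of it on a nonempty compact Hausdorff space has a fixed point), and for every $a_0\in\mathbb{Q}_0$ the stabilizer $H=G_{a_0}=\{g\in G: g(a_0)=a_0\}$ has the following properties: 1. $H$, with the subspace topology, is topologically isomorphic to $\mathrm{Aut}(\mathbb{Q},\le)$; 2. $H$ is inj-key in $G$: if $\sigma_1,\sigma_2\in\mathcal{T}_{\downarrow}(G)$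 and $\sigma_1|_H=\sigma_2|_H$, then $\sigma_1=\sigma_2$; 3. $H$ is not co-minimal in $G$: there is $\sigma\in\mathcal{T}_{\downarrow}(G)$ whose quotient topology $\sigma/H$ on the set $G/H$ of left cosets differs from $\tau_0/H$. -/

import Mathlib

universe u v

section General

/-- The topology of pointwise convergence on a group `G` of permutations of the **discrete** set
`X`: the topology inherited from the product `X ^ X` of discrete spaces along `g ↦ (x ↦ g • x)`. -/
abbrev pointwiseTopology (G : Type u) (X : Type v) [SMul G X] : TopologicalSpace G :=
  TopologicalSpace.induced (fun (g : G) (x : X) => g • x)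
    (@Pi.topologicalSpace X (fun _ => X) (fun _ => ⊥))

/-- The set of all Hausdorff group topologies on `G` that are coarser than (or equal to) the given
topology `γ` of `G`. In Mathlib's order on topologies `γ ≤ σ` means: every `σ`-open set is
`γ`-open. -/
def coarserHausdorffGroupTopologies (G : Type u) [Group G] [γ : TopologicalSpace G] :
    Set (TopologicalSpace G) :=
  {σ | @IsTopologicalGroup G σ _ ∧ @T2Space G σ ∧ γ ≤ σ}

/-- `H` is inj-key in `G`: the restriction map `σ ↦ σ|_H` is injective on the set of all coarser
Hausdorff group topologies on `G`. -/
def IsInjKey {G : Type u} [Group G] [TopologicalSpace G] (H : Subgroup G) : Prop :=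
  Set.InjOn (fun σ : TopologicalSpace G => TopologicalSpace.induced (Subtype.val : H → G) σ)
    (coarserHausdorffGroupTopologies G)

/-- `H` is co-minimal in `G`: every coarser Hausdorff group topology on `G` induces the original
quotient topology on the set `G ⧸ H` of left cosets. -/
def IsCoMinimal {G : Type u} [Group G] [γ : TopologicalSpace G] (H : Subgroup G) : Prop :=
  ∀ σ ∈ coarserHausdorffGroupTopologies G,
    TopologicalSpace.coinduced (QuotientGroup.mk : G → G ⧸ H) σ =
      TopologicalSpace.coinduced (QuotientGroup.mk : G → G ⧸ H) γ

/-- `G` is extremely amenable: every continuous action of `G` on a nonempty compact Hausdorff space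
has a fixed point. -/
def IsExtremelyAmenable (G : Type u) [Group G] [TopologicalSpace G] : Prop :=
  ∀ (X : Type v) [TopologicalSpace X] [CompactSpace X] [T2Space X] [Nonempty X]
    [MulAction G X] [ContinuousSMul G X], ∃ x : X, ∀ g : G, g • x = x

end General

/-- The rational circle `ℚ / ℤ`, with its counter-clockwise circular order (Mathlib's
`QuotientAddGroup.circularOrder`). The strict relation `[a, b, c]` is `sbtw a b c`. -/
abbrev RatCircle : Type := AddCircle (1 : ℚ)

/-- The group of all permutations of the rational circle that preserve its circular order. -/
def circularAut : Subgroup (Equiv.Perm RatCircle) where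
  carrier := {g | ∀ a b c : RatCircle, sbtw (g a) (g b) (g c) ↔ sbtw a b c}
  one_mem' := fun _ _ _ => Iff.rfl
  mul_mem' := fun {g h} hg hh a b c => (hg (h a) (h b) (h c)).trans (hh a b c)
  inv_mem' := fun {g} hg a b c => by
    have h := hg (g⁻¹ a) (g⁻¹ b) (g⁻¹ c)
    rw [← Equiv.Perm.mul_apply g, ← Equiv.Perm.mul_apply g, ← Equiv.Perm.mul_apply g,
      mul_inv_cancel] at h
    exact h.symm

instance circularAut.instTopologicalSpace : TopologicalSpace circularAut :=
  pointwiseTopology circularAut RatCircle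

/-- The group of all order automorphisms of `(ℚ, ≤)` also carries the pointwise topology coming
from the discrete set `ℚ`. -/
instance ratOrderAut.instTopologicalSpace : TopologicalSpace (ℚ ≃o ℚ) :=
  pointwiseTopology (ℚ ≃o ℚ) ℚ

/-! Cutting the rational circle at `a` leaves a copy of `ℚ`, with `a` as an added top element
(`RatCircle.chart`). Hence the stabilizer of `a` is the automorphism group of `ℚ`, topology
included. Extreme amenability of that group is Pestov's argument: Ramsey's theorem yields points
that finitely many group elements almost fix, and compactness turns them into a fixed point.

The other two claims rest on a dichotomy: the only Hausdorff group topologies coarser than the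
pointwise topology are that topology itself and `arcTopology` (`eq_pointwise_or_eq_arcTopology`).
Every Hausdorff group topology refines `arcTopology`, because commutators of elements supported in
an arc detect whether the arc meets its image (`le_arcTopology`). If some point stabilizer is a
neighbourhood of 1, conjugation makes all of them so, and the topology is pointwise. Otherwise small
elements move any finite set off itself, and products of stabilizers of disjoint finite sets are
`arcTopology`-neighbourhoods of 1, which forces equality.

Small translations in the chart at `a` fix `a`, move every other point, and tend to 1 in
`arcTopology`. So the two topologies differ on the stabilizer, which gives inj-key. Used at another
base point, they show that the stabilizer is not `arcTopology`-open, so its quotient is not discrete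
and co-minimality fails. -/

open Set Filter Topology Uniformity

/-! ### Homogeneity of the rational order -/

section Homogeneity

/-- A finite partial isomorphism between countable dense linear orders without endpoints extends to
an isomorphism. -/
theorem Order.exists_orderIso_extending {α β : Type*} [LinearOrder α] [LinearOrder β]
    [Countable α] [DenselyOrdered α] [NoMinOrder α] [NoMaxOrder α] [Nonempty α]
    [Countable β] [DenselyOrdered β] [NoMinOrder β] [NoMaxOrder β] [Nonempty β]
    (p : Order.PartialIso α β) : ∃ e : α ≃o β, ∀ q ∈ p.val, e q.1 = q.2 := by
  classical
  cases nonempty_encodable α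
  cases nonempty_encodable β
  let D : α ⊕ β → Order.Cofinal (Order.PartialIso α β) := fun p ↦
    Sum.recOn p (Order.PartialIso.definedAtLeft β) (Order.PartialIso.definedAtRight α)
  -- Cantor's back-and-forth, started at `p` instead of the empty map.
  let I : Order.Ideal (Order.PartialIso α β) := Order.idealOfCofinals p D
  let F a := Order.PartialIso.funOfIdeal a I (Order.cofinal_meets_idealOfCofinals _ D (Sum.inl a))
  let G b := Order.PartialIso.invOfIdeal b I (Order.cofinal_meets_idealOfCofinals _ D (Sum.inr b))
  refine ⟨OrderIso.ofCmpEqCmp (fun a ↦ (F a).val) (fun b ↦ (G b).val) fun a b ↦ ?_, ?_⟩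
  · rcases (F a).prop with ⟨f, hf, ha⟩
    rcases (G b).prop with ⟨g, hg, hb⟩
    rcases I.directed _ hf _ hg with ⟨m, _, fm, gm⟩
    exact m.prop (a, _) (fm ha) (_, b) (gm hb)
  · intro q hq
    change (F q.1).val = q.2
    rcases (F q.1).prop with ⟨f, hf, ha⟩
    rcases I.directed _ hf _ (Order.mem_idealOfCofinals p D) with ⟨m, _, fm, pm⟩
    have := m.prop (q.1, _) (fm ha) q (pm hq)
    simpa using this.symm

theorem exists_ratOrderIso_eqOn (S : Finset ℚ) (j : ℚ → ℚ) (hj : StrictMonoOn j S) :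
    ∃ g : ℚ ≃o ℚ, ∀ x ∈ S, g x = j x := by
  classical
  obtain ⟨e, he⟩ := Order.exists_orderIso_extending
    (⟨S.image fun x => (x, j x), by
      simp only [Finset.mem_image]
      rintro _ ⟨x, hx, rfl⟩ _ ⟨y, hy, rfl⟩
      exact (hj.cmp_map_eq hx hy).symm⟩ : Order.PartialIso ℚ ℚ)
  exact ⟨e, fun x hx => he (x, j x) (Finset.mem_image_of_mem _ hx)⟩

theorem exists_ratOrderIso_map_eq {S T : Finset ℚ} (h : S.card = T.card) :
    ∃ g : ℚ ≃o ℚ, S.map g.toEquiv.toEmbedding = T := by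
  classical
  let e : S ≃o T := (S.orderIsoOfFin h).symm.trans (T.orderIsoOfFin rfl)
  obtain ⟨g, hg⟩ := exists_ratOrderIso_eqOn S
    (fun x => if hx : x ∈ S then (e ⟨x, hx⟩ : ℚ) else x) (by
      intro x hx y hy hxy
      have hx' : x ∈ S := hx
      have hy' : y ∈ S := hy
      simpa [hx', hy'] using hxy)
  refine ⟨g, Finset.eq_of_subset_of_card_le ?_ (by simp [h])⟩
  intro y hy
  obtain ⟨x, hx, rfl⟩ := Finset.mem_map.1 hy
  change g x ∈ T
  rw [hg x hx]
  simp [hx]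

/-- An order automorphism preserving a finite set fixes it pointwise. -/
theorem OrderIso.apply_eq_of_map_eq {α : Type*} [LinearOrder α] (m : α ≃o α) (F : Finset α)
    (h : F.map m.toEquiv.toEmbedding = F) {x : α} (hx : x ∈ F) : m x = x := by
  have key : ∀ i, m (F.orderEmbOfFin rfl i) = F.orderEmbOfFin rfl i := by
    refine congrFun (Finset.orderEmbOfFin_unique (f := m ∘ F.orderEmbOfFin rfl) rfl
      (fun i => ?_) (m.strictMono.comp (F.orderEmbOfFin rfl).strictMono))
    have := Finset.mem_map_of_mem m.toEquiv.toEmbedding (F.orderEmbOfFin_mem rfl i)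
    rwa [h] at this
  have : x ∈ Set.range (F.orderEmbOfFin rfl) := by simpa using hx
  obtain ⟨i, rfl⟩ := this
  exact key i

end Homogeneity

/-! ### Ramsey's theorem -/

section Ramsey

/-- The infinite Ramsey theorem for `k`-element subsets. -/
theorem exists_infinite_monochromatic {α κ : Type*} [Finite κ] (k : ℕ) :
    ∀ (c : Finset α → κ) (M : Set α), M.Infinite →
      ∃ M' ⊆ M, M'.Infinite ∧ ∃ i, ∀ s : Finset α, ↑s ⊆ M' → s.card = k → c s = i := by
  classical
  induction k with
  | zero =>
    intro c M hM
    refine ⟨M, subset_rfl, hM, c ∅, fun s _ hs => ?_⟩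
    rw [Finset.card_eq_zero.1 hs]
  | succ k ih =>
    intro c M hM
    have step : ∀ A : {A : Set α // A.Infinite}, ∃ (m : α) (B : {A : Set α // A.Infinite}) (i : κ),
        m ∈ A.1 ∧ B.1 ⊆ A.1 \ {m} ∧
          ∀ s : Finset α, ↑s ⊆ B.1 → s.card = k → c (insert m s) = i := by
      intro A
      obtain ⟨m, hm⟩ := A.2.nonempty
      obtain ⟨B, hBA, hB, i, hi⟩ := ih (fun s => c (insert m s)) (A.1 \ {m})
        (A.2.sdiff (Set.finite_singleton m))
      exact ⟨m, ⟨B, hB⟩, i, hm, hBA, hi⟩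
    choose pick next col hpick hnext hcol using step
    let S : ℕ → {A : Set α // A.Infinite} := fun n => next^[n] ⟨M, hM⟩
    have hS : ∀ n, S (n + 1) = next (S n) := fun n => Function.iterate_succ_apply' _ _ _
    have hanti : Antitone fun n => (S n).1 := antitone_nat_of_succ_le fun n => by
      rw [hS]
      exact (hnext _).trans Set.sdiff_subset
    let m : ℕ → α := fun n => pick (S n)
    have hlt : ∀ n n', n < n' → m n' ∈ (next (S n)).1 := fun n n' h => by
      rw [← hS]
      exact hanti (Nat.succ_le_of_lt h) (hpick (S n'))
    have hminj : Function.Injective m := by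
      intro n n' h
      by_contra hne
      rcases lt_or_gt_of_ne hne with hl | hl
      · exact (hnext _ (hlt _ _ hl)).2 h.symm
      · exact (hnext _ (hlt _ _ hl)).2 h
    -- The colour of a set of `k + 1` terms of `m` depends only on its term of least index, so the
    -- pigeonhole principle on indices suffices.
    obtain ⟨i, hi⟩ := Finite.exists_infinite_fiber fun n => col (S n)
    have hi' : ((fun n => col (S n)) ⁻¹' {i}).Infinite := Set.infinite_coe_iff.1 hi
    refine ⟨m '' ((fun n => col (S n)) ⁻¹' {i}), ?_, hi'.image hminj.injOn, i, ?_⟩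
    · rintro _ ⟨n, -, rfl⟩
      exact hanti (Nat.zero_le n) (hpick (S n))
    · intro s hs hcard
      have hex : ∃ n, m n ∈ s := by
        obtain ⟨x, hx⟩ := Finset.card_pos.1 (by omega : 0 < s.card)
        obtain ⟨n, -, rfl⟩ := hs hx
        exact ⟨n, hx⟩
      have hn := Nat.find_spec hex
      set n := Nat.find hex with hndef
      have hcoln : col (S n) = i := by
        obtain ⟨n', h', he⟩ := hs hn
        rw [hminj he] at h'
        exact h'
      rw [← Finset.insert_erase hn, ← hcoln]
      refine hcol (S n) _ ?_ (by rw [Finset.card_erase_of_mem hn]; omega)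
      intro x hx
      have hx' := Finset.mem_erase.1 hx
      obtain ⟨n', -, rfl⟩ := hs hx'.2
      refine hlt _ _ (lt_of_le_of_ne (Nat.find_min' hex hx'.2) ?_)
      rintro h
      exact hx'.1 (by rw [h])

end Ramsey

/-! ### Pointwise topologies -/

section Pointwise

theorem isOpen_pointwise_smul_eq (G : Type*) {X : Type*} [SMul G X] (x y : X) :
    @IsOpen G (pointwiseTopology G X) {g | g • x = y} := by
  let : TopologicalSpace X := ⊥
  have : DiscreteTopology X := ⟨rfl⟩
  let : TopologicalSpace G := pointwiseTopology G X
  have h : Continuous fun g : G => g • x := (continuous_apply x).comp continuous_induced_dom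
  exact (isOpen_discrete {y}).preimage h

theorem continuous_pointwise_iff {G X T : Type*} [SMul G X] [TopologicalSpace T] {f : T → G} :
    @Continuous T G _ (pointwiseTopology G X) f ↔ ∀ x y : X, IsOpen {t | f t • x = y} := by
  let : TopologicalSpace X := ⊥
  have : DiscreteTopology X := ⟨rfl⟩
  rw [continuous_induced_rng, continuous_pi_iff]
  refine forall_congr' fun x => ?_
  exact continuous_discrete_rng

theorem exists_finset_of_mem_nhds_one_pointwise {G X : Type*} [Group G] [MulAction G X] {U : Set G}
    (hU : U ∈ @nhds G (pointwiseTopology G X) 1) :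
    ∃ F : Finset X, ∀ g : G, (∀ x ∈ F, g • x = x) → g ∈ U := by
  let : TopologicalSpace X := ⊥
  have : DiscreteTopology X := ⟨rfl⟩
  rw [nhds_induced, mem_comap] at hU
  obtain ⟨W, hW, hWU⟩ := hU
  rw [nhds_pi, Filter.mem_pi] at hW
  obtain ⟨I, hI, t, ht, htW⟩ := hW
  refine ⟨hI.toFinset, fun g hg => hWU (htW fun x hx => ?_)⟩
  have : g • x = x := hg x (hI.mem_toFinset.2 hx)
  simp only [this]
  simpa using mem_of_mem_nhds (ht x)

theorem isTopologicalGroup_pointwise (G X : Type*) [Group G] [MulAction G X] :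
    @IsTopologicalGroup G (pointwiseTopology G X) _ := by
  let : TopologicalSpace G := pointwiseTopology G X
  refine { continuous_mul := ?_, continuous_inv := ?_ }
  · rw [continuous_pointwise_iff]
    intro x y
    have : {t : G × G | (t.1 * t.2) • x = y} =
        ⋃ z : X, {g : G | g • z = y} ×ˢ {h : G | h • x = z} := by
      ext t
      simp [mul_smul]
    rw [this]
    exact isOpen_iUnion fun z =>
      (isOpen_pointwise_smul_eq G z y).prod (isOpen_pointwise_smul_eq G x z)
  · rw [continuous_pointwise_iff]
    intro x y
    simp_rw [inv_smul_eq_iff, eq_comm (a := x)]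
    exact isOpen_pointwise_smul_eq G y x

end Pointwise

/-! ### Extreme amenability of the automorphism group of the rationals -/

section ExtremeAmenability

/-- A group acting continuously on a compact space acts equicontinuously near the identity. -/
theorem eventually_forall_smul_mem_uniformity {G X : Type*} [Group G] [TopologicalSpace G]
    [UniformSpace X] [CompactSpace X] [MulAction G X] [ContinuousSMul G X]
    {V : Set (X × X)} (hV : V ∈ 𝓤 X) : ∀ᶠ g : G in 𝓝 1, ∀ x : X, (x, g • x) ∈ V := by
  have := isCompact_univ.eventually_forall_of_forall_eventually (x₀ := (1 : G))
    (P := fun g (x : X) => (x, g • x) ∈ V) (K := Set.univ) ?_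
  · simpa using this
  · intro x _
    have hc : Continuous fun z : G × X => (z.2, z.1 • z.2) := by fun_prop
    have h := hc.tendsto (1, x)
    simp only [one_smul] at h
    exact h.eventually (nhds_le_uniformity x hV)

/-- Elements fixing a suitable finite `F` pointwise barely move any point of `X`. Hence, up to a
small error, `g⁻¹ • x₀` depends only on the image of `F` under `g`, and this gives a finite
colouring of the `F.card`-element sets of rationals. Pushing all the relevant translates of `F` into
a monochromatic set makes the corresponding points close to each other. -/
theorem ratOrderAut_exists_almost_fixed {X : Type*} [UniformSpace X] [CompactSpace X] [Nonempty X]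
    [MulAction (ℚ ≃o ℚ) X] [ContinuousSMul (ℚ ≃o ℚ) X] (V : Set (X × X)) (hV : V ∈ 𝓤 X)
    (S : Finset (ℚ ≃o ℚ)) : ∃ x : X, ∀ g ∈ S, (x, g • x) ∈ V := by
  classical
  obtain ⟨V₁, hV₁, hsymm₁, hV₁V⟩ := comp_symm_mem_uniformity_sets hV
  obtain ⟨V₀, hV₀, hsymm, hV₀V⟩ := comp_symm_mem_uniformity_sets hV₁
  obtain ⟨F, hF⟩ := exists_finset_of_mem_nhds_one_pointwise
    (eventually_forall_smul_mem_uniformity (G := ℚ ≃o ℚ) hV₀)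
  obtain ⟨t, ht, hcov⟩ := isCompact_univ.totallyBounded (s := (Set.univ : Set X)) V₀ hV₀
  have hcov' : ∀ x : X, ∃ y : t, (x, (y : X)) ∈ V₀ := fun x => by
    have := hcov (Set.mem_univ x)
    simpa using this
  choose near hnear using hcov'
  have : Finite t := ht
  let x₀ : X := Classical.arbitrary X
  have hk : ∀ s : Finset ℚ, ∃ g : ℚ ≃o ℚ, F.card = s.card → F.map g.toEquiv.toEmbedding = s := by
    intro s
    by_cases h : F.card = s.card
    · obtain ⟨g, hg⟩ := exists_ratOrderIso_map_eq h
      exact ⟨g, fun _ => hg⟩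
    · exact ⟨1, fun h' => absurd h' h⟩
  choose k hk using hk
  obtain ⟨M, -, hM, i, hi⟩ := exists_infinite_monochromatic F.card
    (fun s => near ((k s)⁻¹ • x₀)) (Set.univ : Set ℚ) Set.infinite_univ
  -- Including 1 puts the point `h⁻¹ • x₀` itself among those compared with `i`.
  let S' := insert 1 S
  let E : Finset ℚ := S'.biUnion fun g => F.map (g⁻¹ : ℚ ≃o ℚ).toEquiv.toEmbedding
  obtain ⟨T, hTM, hT⟩ := hM.exists_subset_card_eq E.card
  obtain ⟨h, hh⟩ := exists_ratOrderIso_map_eq hT.symm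
  have hclose : ∀ g ∈ S', ((g * h⁻¹) • x₀, (i : X)) ∈ V₁ := by
    intro g hg
    let s : Finset ℚ := F.map (h * g⁻¹ : ℚ ≃o ℚ).toEquiv.toEmbedding
    have hsM : (s : Set ℚ) ⊆ M := by
      refine Set.Subset.trans ?_ hTM
      intro x hx
      obtain ⟨y, hy, rfl⟩ := Finset.mem_map.1 (Finset.mem_coe.1 hx)
      rw [← hh]
      exact Finset.mem_coe.2 (Finset.mem_map_of_mem h.toEquiv.toEmbedding
        (Finset.mem_biUnion.2 ⟨g, hg, Finset.mem_map_of_mem (g⁻¹ : ℚ ≃o ℚ).toEquiv.toEmbedding hy⟩))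
    have hcard : s.card = F.card := Finset.card_map _
    have hcol := hi s hsM hcard
    -- Both `k s` and `h * g⁻¹` carry `F` onto `s`, so this element preserves `F`, hence fixes it
    -- pointwise.
    have hfix : ∀ x ∈ F, (g * h⁻¹ * k s) • x = x := fun x hx => by
      refine OrderIso.apply_eq_of_map_eq (g * h⁻¹ * k s) F ?_ hx
      have h1 := hk s hcard.symm
      ext y
      simp only [Finset.mem_map_equiv]
      have h2 : ∀ z, z ∈ s ↔ (k s).symm z ∈ F := fun z => by
        conv_lhs => rw [← h1]
        simp only [Finset.mem_map_equiv]; rfl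
      have h3 : ∀ z, z ∈ s ↔ (h * g⁻¹).symm z ∈ F := fun z => by
        simp only [s, Finset.mem_map_equiv]; rfl
      change (k s).symm ((g * h⁻¹).symm y) ∈ F ↔ _
      rw [← h2, h3]
      have : (h * g⁻¹).symm ((g * h⁻¹).symm y) = y := by
        change (h * g⁻¹)⁻¹ ((g * h⁻¹)⁻¹ y) = y
        rw [← RelIso.mul_apply]
        simp
      rw [this]
    have h4 := hF _ hfix ((k s)⁻¹ • x₀)
    rw [smul_smul, mul_inv_cancel_right] at h4
    refine hV₀V ⟨_, SetRel.symm V₀ h4, ?_⟩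
    rw [← hcol]
    exact hnear _
  refine ⟨h⁻¹ • x₀, fun g hg => hV₁V ⟨i, ?_, ?_⟩⟩
  · simpa using hclose 1 (Finset.mem_insert_self _ _)
  · rw [smul_smul]
    exact SetRel.symm V₁ (hclose g (Finset.mem_insert_of_mem hg))

/-- The sets of points moved within a closed entourage by a given element are closed and have the
finite intersection property; a common point is fixed. -/
theorem ratOrderAut_isExtremelyAmenable : IsExtremelyAmenable.{0, v} (ℚ ≃o ℚ) := by
  intro X _ _ _ _ _ _
  let : UniformSpace X := uniformSpaceOfCompactR1
  let Z : {V : Set (X × X) // V ∈ 𝓤 X ∧ IsClosed V} × (ℚ ≃o ℚ) → Set X :=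
    fun p => {x | (x, p.2 • x) ∈ p.1.1}
  have hne : (Set.univ ∩ ⋂ p, Z p).Nonempty := by
    refine isCompact_univ.inter_iInter_nonempty Z (fun p => ?_) fun u => ?_
    · exact p.1.2.2.preimage (by fun_prop : Continuous fun x : X => (x, p.2 • x))
    · classical
      obtain ⟨x, hx⟩ := ratOrderAut_exists_almost_fixed (⋂ p ∈ u, p.1.1 : Set (X × X))
        ((Filter.biInter_finset_mem u).2 fun p _ => p.1.2.1) (u.image Prod.snd)
      refine ⟨x, trivial, Set.mem_iInter₂.2 fun p hp => ?_⟩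
      exact Set.mem_iInter₂.1 (hx p.2 (Finset.mem_image_of_mem _ hp)) p hp
  obtain ⟨x, -, hx⟩ := hne
  refine ⟨x, fun g => (eq_of_uniformity_basis uniformity_hasBasis_closed ?_).symm⟩
  intro V hV
  exact Set.mem_iInter.1 hx (⟨V, hV⟩, g)

end ExtremeAmenability

/-! ### Cutting the circle at a point -/

section Chart

theorem sbtw_coe_iff_of_mem_Ioc {r x y z : ℚ} (hx : x ∈ Set.Ioc r (r + 1))
    (hy : y ∈ Set.Ioc r (r + 1)) (hz : z ∈ Set.Ioc r (r + 1)) :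
    sbtw (x : RatCircle) (y : RatCircle) (z : RatCircle) ↔
      (x < y ∧ y < z) ∨ (y < z ∧ z < x) ∨ (z < x ∧ x < y) := by
  rw [sbtw_iff_not_btw]
  have hbtw : btw (z : RatCircle) (y : RatCircle) (x : RatCircle) ↔
      toIcoMod one_pos z y ≤ toIocMod one_pos z x := QuotientAddGroup.btw_coe_iff
  rw [hbtw, not_le]
  obtain ⟨hx1, hx2⟩ := hx
  obtain ⟨hy1, hy2⟩ := hy
  obtain ⟨hz1, hz2⟩ := hz
  have e1 : toIcoMod one_pos z y = if z ≤ y then y else y + 1 := by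
    split_ifs with h
    · exact (toIcoMod_eq_iff _).2 ⟨⟨h, by linarith⟩, 0, by simp⟩
    · exact (toIcoMod_eq_iff _).2 ⟨⟨by linarith, by linarith⟩, -1, by simp⟩
  have e2 : toIocMod one_pos z x = if z < x then x else x + 1 := by
    split_ifs with h
    · exact (toIocMod_eq_iff _).2 ⟨⟨h, by linarith⟩, 0, by simp⟩
    · exact (toIocMod_eq_iff _).2 ⟨⟨by linarith, by linarith⟩, -1, by simp⟩
  rw [e1, e2]
  grind

/-- The rational circle, cut at a point, is the rational line with that point as an endpoint. -/
theorem RatCircle.exists_chart (a : RatCircle) : ∃ E : RatCircle ≃ WithTop ℚ, E a = ⊤ ∧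
    ∀ x y z, sbtw x y z ↔
      (E x < E y ∧ E y < E z) ∨ (E y < E z ∧ E z < E x) ∨ (E z < E x ∧ E x < E y) := by
  obtain ⟨r, rfl⟩ := QuotientAddGroup.mk_surjective a
  have : Nonempty (Set.Ioo r (r + 1)) := ⟨⟨r + 1 / 2, by constructor <;> linarith⟩⟩
  obtain ⟨ψ⟩ := Order.iso_of_countable_dense ℚ (Set.Ioo r (r + 1))
  -- The cut point is represented by the right end `r + 1`, which matches `⊤`.
  let D : WithTop ℚ → ℚ := fun t => t.recTopCoe (r + 1) (fun q => ψ q)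
  have Dtop : D ⊤ = r + 1 := rfl
  have Dcoe : ∀ q : ℚ, D q = ψ q := fun q => rfl
  have Dmem : ∀ t, D t ∈ Set.Ioc r (r + 1) := by
    intro t
    induction t with
    | top => rw [Dtop]; constructor <;> linarith
    | coe q => rw [Dcoe]; exact ⟨(ψ q).2.1, (ψ q).2.2.le⟩
  have Dmono : StrictMono D := by
    intro s t hst
    induction t with
    | top =>
      induction s with
      | top => exact absurd hst (lt_irrefl _)
      | coe q => rw [Dtop, Dcoe]; exact (ψ q).2.2
    | coe p =>
      induction s with
      | top => exact absurd hst (by simp)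
      | coe q =>
        rw [Dcoe, Dcoe]
        exact ψ.strictMono (WithTop.coe_lt_coe.1 hst)
  have Dsurj : ∀ u ∈ Set.Ioc r (r + 1), ∃ t, D t = u := by
    intro u hu
    rcases hu.2.lt_or_eq with h | h
    · refine ⟨(ψ.symm ⟨u, hu.1, h⟩ : ℚ), ?_⟩
      rw [Dcoe]; simp
    · exact ⟨⊤, h.symm⟩
  let D' : WithTop ℚ ≃ Set.Ioc r (r + 1) := Equiv.ofBijective (fun t => ⟨D t, Dmem t⟩)
    ⟨fun s t h => Dmono.injective (congrArg Subtype.val h), fun u => by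
      obtain ⟨t, ht⟩ := Dsurj u.1 u.2
      exact ⟨t, Subtype.ext ht⟩⟩
  let E : RatCircle ≃ WithTop ℚ := (AddCircle.equivIoc (1 : ℚ) r).trans D'.symm
  have hE : ∀ x, ((D (E x) : ℚ) : RatCircle) = x := by
    intro x
    have : (⟨D (E x), Dmem (E x)⟩ : Set.Ioc r (r + 1)) = AddCircle.equivIoc (1 : ℚ) r x :=
      D'.apply_symm_apply _
    have h2 := congrArg Subtype.val this
    simp only at h2
    rw [h2]
    exact AddCircle.coe_equivIoc
  refine ⟨E, ?_, fun x y z => ?_⟩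
  · have hr : r + 1 ∈ Set.Ioc r (r + 1) := by constructor <;> linarith
    have h1 : ((r : ℚ) : RatCircle) = ((r + 1 : ℚ) : RatCircle) :=
      (AddCircle.coe_add_period (1 : ℚ) r).symm
    change D'.symm (AddCircle.equivIoc (1 : ℚ) r (r : RatCircle)) = ⊤
    rw [h1, Equiv.symm_apply_eq]
    exact Subtype.ext (AddCircle.equivIoc_coe_of_mem hr)
  · conv_lhs => rw [← hE x, ← hE y, ← hE z]
    rw [sbtw_coe_iff_of_mem_Ioc (Dmem _) (Dmem _) (Dmem _)]
    simp only [Dmono.lt_iff_lt]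

/-- A chart of the rational circle cut at `a`. -/
noncomputable def RatCircle.chart (a : RatCircle) : RatCircle ≃ WithTop ℚ :=
  (RatCircle.exists_chart a).choose

open RatCircle

@[simp]
theorem RatCircle.chart_self (a : RatCircle) : chart a a = ⊤ :=
  (RatCircle.exists_chart a).choose_spec.1

theorem RatCircle.sbtw_iff_chart (a : RatCircle) {x y z : RatCircle} : sbtw x y z ↔
    (chart a x < chart a y ∧ chart a y < chart a z) ∨
      (chart a y < chart a z ∧ chart a z < chart a x) ∨
        (chart a z < chart a x ∧ chart a x < chart a y) :=
  (RatCircle.exists_chart a).choose_spec.2 x y z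

theorem RatCircle.chart_eq_top {a x : RatCircle} : chart a x = ⊤ ↔ x = a := by
  rw [← chart_self a, (chart a).apply_eq_iff_eq]

theorem RatCircle.sbtw_base_iff {a x y : RatCircle} :
    sbtw a x y ↔ chart a x < chart a y ∧ y ≠ a := by
  rw [sbtw_iff_chart a, chart_self, Ne, ← chart_eq_top (a := a), ← Ne,
    ← lt_top_iff_ne_top]
  have h1 : ¬ (⊤ < chart a x) := not_top_lt
  have h2 : ¬ (⊤ < chart a y) := not_top_lt
  tauto

theorem RatCircle.chart_symm_coe_ne (a : RatCircle) (q : ℚ) : (chart a).symm q ≠ a := by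
  rw [Ne, ← chart_eq_top (a := a), Equiv.apply_symm_apply]
  exact WithTop.coe_ne_top

theorem RatCircle.sbtw_left_ne {x y z : RatCircle} (h : sbtw x y z) : y ≠ x := by
  rintro rfl
  exact sbtw_irrefl_left h

theorem RatCircle.sbtw_right_ne {x y z : RatCircle} (h : sbtw x y z) : y ≠ z := by
  rintro rfl
  exact sbtw_irrefl_right h

theorem RatCircle.exists_sbtw {x y : RatCircle} (h : x ≠ y) : ∃ z, sbtw x z y := by
  have hy : chart x y ≠ ⊤ := fun h' => h (chart_eq_top.1 h').symm
  obtain ⟨q, hq⟩ := WithTop.ne_top_iff_exists.1 hy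
  refine ⟨(chart x).symm ((q - 1 : ℚ) : WithTop ℚ), sbtw_base_iff.2 ⟨?_, h.symm⟩⟩
  rw [Equiv.apply_symm_apply, ← hq]
  exact WithTop.coe_lt_coe.2 (by linarith)

end Chart

/-! ### Stabilizers, transitivity and extension of finite partial maps -/

section CircularAut

open RatCircle

theorem circularAut.sbtw_smul (g : circularAut) {x y z : RatCircle} :
    sbtw (g • x) (g • y) (g • z) ↔ sbtw x y z := g.2 x y z

theorem circularAut.ext_smul {g h : circularAut} (H : ∀ x : RatCircle, g • x = h • x) : g = h :=
  Subtype.ext (Equiv.ext H)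

/-- The circular automorphism fixing `a` that acts as `f` on the chart at `a`. -/
noncomputable def circularAut.ofRat (a : RatCircle) (f : ℚ ≃o ℚ) : circularAut :=
  ⟨((chart a).trans f.withTopCongr.toEquiv).trans (chart a).symm, fun x y z => by
    rw [sbtw_iff_chart a, sbtw_iff_chart a]
    simp only [Equiv.trans_apply, Equiv.apply_symm_apply, RelIso.coe_fn_toEquiv,
      OrderIso.lt_iff_lt]⟩

open circularAut

theorem circularAut.chart_ofRat_smul (a : RatCircle) (f : ℚ ≃o ℚ) (x : RatCircle) :
    chart a (ofRat a f • x) = f.withTopCongr (chart a x) :=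
  (chart a).apply_symm_apply _

theorem circularAut.ofRat_smul_self (a : RatCircle) (f : ℚ ≃o ℚ) : ofRat a f • a = a := by
  rw [← chart_eq_top (a := a), chart_ofRat_smul, chart_self]
  exact map_top _

theorem circularAut.ofRat_smul_symm_coe (a : RatCircle) (f : ℚ ≃o ℚ) (q : ℚ) :
    ofRat a f • (chart a).symm q = (chart a).symm (f q) := by
  rw [← (chart a).apply_eq_iff_eq, chart_ofRat_smul]
  simp

/-- The embedding of the order automorphisms of `ℚ` as the stabilizer of a point. -/
noncomputable def circularAut.ofRatHom (a : RatCircle) :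
    (ℚ ≃o ℚ) →* MulAction.stabilizer circularAut a where
  toFun f := ⟨ofRat a f, ofRat_smul_self a f⟩
  map_one' := Subtype.ext <| ext_smul fun x => by
    apply (chart a).injective
    rw [chart_ofRat_smul]
    change _ = chart a x
    induction chart a x <;> rfl
  map_mul' f g := Subtype.ext <| ext_smul fun x => by
    change ofRat a (f * g) • x = (ofRat a f * ofRat a g) • x
    apply (chart a).injective
    rw [mul_smul]
    simp only [chart_ofRat_smul]
    induction chart a x <;> rfl

theorem circularAut.exists_ofRat_eq {a : RatCircle} {g : circularAut} (hg : g • a = a) :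
    ∃ f, ofRat a f = g := by
  have hne : ∀ (h : circularAut), h • a = a → ∀ q : ℚ, chart a (h • (chart a).symm q) ≠ ⊤ := by
    intro h hh q hq
    rw [chart_eq_top] at hq
    exact chart_symm_coe_ne a q (smul_left_cancel h (hq.trans hh.symm))
  have hg' : g⁻¹ • a = a := by rw [inv_smul_eq_iff, hg]
  have hinv : ∀ (h : circularAut) (hh : h • a = a) (hh' : h⁻¹ • a = a) (q : ℚ),
      (chart a (h⁻¹ • (chart a).symm
        ((chart a (h • (chart a).symm q)).untop (hne h hh q) : ℚ))).untop (hne _ hh' _) = q := by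
    intro h hh hh' q
    simp
  let f : ℚ ≃o ℚ :=
    { toFun := fun q => (chart a (g • (chart a).symm q)).untop (hne g hg q)
      invFun := fun q => (chart a (g⁻¹ • (chart a).symm q)).untop (hne g⁻¹ hg' q)
      left_inv := hinv g hg hg'
      right_inv := fun q => by simp
      map_rel_iff' := by
        have key : ∀ p q : ℚ, (chart a (g • (chart a).symm q)).untop (hne g hg q) <
            (chart a (g • (chart a).symm p)).untop (hne g hg p) ↔ q < p := fun p q => by
          have h := sbtw_smul g (x := a) (y := (chart a).symm q) (z := (chart a).symm p)
          rw [hg, sbtw_base_iff, sbtw_base_iff] at h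
          have h1 := chart_symm_coe_ne a p
          have h2 := (not_iff_not.2 (chart_eq_top (a := a))).1 (hne g hg p)
          simp only [h1, h2, ne_eq, not_false_eq_true, and_true, Equiv.apply_symm_apply,
            WithTop.coe_lt_coe] at h
          simpa using h
        intro p q
        exact le_iff_le_iff_lt_iff_lt.2 (key p q) }
  refine ⟨f, ext_smul fun x => (chart a).injective ?_⟩
  rw [chart_ofRat_smul]
  by_cases hx : x = a
  · subst hx
    rw [hg, chart_self]
    exact map_top _
  · have hx' : chart a x ≠ ⊤ := fun h => hx (chart_eq_top.1 h)
    obtain ⟨q, hq⟩ := WithTop.ne_top_iff_exists.1 hx'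
    have hxq : x = (chart a).symm q := by rw [hq]; simp
    rw [hxq, Equiv.apply_symm_apply]
    exact WithTop.coe_untop _ _

theorem circularAut.ofRatHom_bijective (a : RatCircle) : Function.Bijective (ofRatHom a) := by
  refine ⟨fun f g h => ?_, fun g => ?_⟩
  · have h' : ofRat a f = ofRat a g := congrArg Subtype.val h
    ext q
    have := ofRat_smul_symm_coe a f q
    rw [h', ofRat_smul_symm_coe] at this
    simpa using this.symm
  · obtain ⟨f, hf⟩ := exists_ofRat_eq (a := a) (g := g.1) g.2
    exact ⟨f, Subtype.ext hf⟩

/-- The stabilizer of a point is topologically isomorphic to the automorphism group of `ℚ`. -/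
noncomputable def circularAut.stabilizerEquiv (a : RatCircle) :
    MulAction.stabilizer circularAut a ≃ₜ* (ℚ ≃o ℚ) := by
  refine ContinuousMulEquiv.symm
    { MulEquiv.ofBijective (ofRatHom a) (ofRatHom_bijective a) with
      continuous_toFun := ?_
      continuous_invFun := ?_ }
  · refine Continuous.subtype_mk (f := fun f => ofRat a f) ?_ _
    rw [continuous_pointwise_iff]
    intro x y
    by_cases hx : x = a
    · subst hx
      simp_rw [ofRat_smul_self]
      exact isOpen_const
    · have hx' : chart a x ≠ ⊤ := fun h => hx (chart_eq_top.1 h)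
      obtain ⟨q, hq⟩ := WithTop.ne_top_iff_exists.1 hx'
      have hxq : x = (chart a).symm q := by rw [hq]; simp
      have : {f : ℚ ≃o ℚ | ofRat a f • x = y} =
          ⋃ p ∈ {p : ℚ | (chart a).symm p = y}, {f : ℚ ≃o ℚ | f • q = p} := by
        ext f
        rw [hxq]
        simp [ofRat_smul_symm_coe]
      rw [this]
      exact isOpen_biUnion fun p _ => isOpen_pointwise_smul_eq (ℚ ≃o ℚ) q p
  · rw [continuous_pointwise_iff]
    intro q p
    have : {g | (MulEquiv.ofBijective (ofRatHom a) (ofRatHom_bijective a)).symm g • q = p} =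
        Subtype.val ⁻¹' {g : circularAut |
          g • (chart a).symm (q : WithTop ℚ) = (chart a).symm (p : WithTop ℚ)} := by
      ext g
      obtain ⟨f, rfl⟩ := (ofRatHom_bijective a).2 g
      have h1 : (MulEquiv.ofBijective (ofRatHom a) (ofRatHom_bijective a)).symm (ofRatHom a f) = f :=
        (MulEquiv.ofBijective (ofRatHom a) (ofRatHom_bijective a)).symm_apply_apply f
      have h2 : (ofRatHom a f).1 = ofRat a f := rfl
      simp only [Set.mem_ofPred_eq, Set.mem_preimage, h1, h2, ofRat_smul_symm_coe]
      simp
    exact this ▸ (isOpen_pointwise_smul_eq circularAut _ _).preimage continuous_subtype_val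

theorem circularAut.exists_smul_eq (x y : RatCircle) :
    ∃ g : circularAut, g • x = y := by
  refine ⟨⟨(chart x).trans (chart y).symm, fun a b c => ?_⟩, ?_⟩
  · rw [sbtw_iff_chart y, sbtw_iff_chart x]
    simp only [Equiv.trans_apply, Equiv.apply_symm_apply]
  · change (chart y).symm (chart x x) = y
    rw [chart_self, ← chart_self y, Equiv.symm_apply_apply]

/-- A finite partial map fixing `a` and preserving the circular order extends to an automorphism. -/
theorem circularAut.exists_eqOn_of_sbtw {a : RatCircle} (S : Finset RatCircle)
    (j : RatCircle → RatCircle) (hS : a ∉ S) (hj : ∀ x ∈ S, j x ≠ a)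
    (h : ∀ x ∈ S, ∀ y ∈ S, sbtw a x y → sbtw a (j x) (j y)) :
    ∃ g : circularAut, g • a = a ∧ ∀ x ∈ S, g • x = j x := by
  classical
  -- The default 0 occurs only at `a`, which lies neither in `S` nor in its image under `j`.
  let u : RatCircle → ℚ := fun x => (chart a x).untopD 0
  have hu : ∀ x, x ≠ a → chart a x = u x := fun x hx =>
by
    obtain ⟨q, hq⟩ := WithTop.ne_top_iff_exists.1 fun h => hx (chart_eq_top.1 h)
    simp [u, ← hq]
  have hSa : ∀ x ∈ S, x ≠ a := fun x hx h => hS (h ▸ hx)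
  have hsu : ∀ x, x ≠ a → (chart a).symm (u x) = x := fun x hx => by
    rw [← hu x hx, Equiv.symm_apply_apply]
  obtain ⟨f, hf⟩ := exists_ratOrderIso_eqOn (S.image u) (fun q => u (j ((chart a).symm q))) (by
    intro p hp q hq hpq
    obtain ⟨x, hx, rfl⟩ := Finset.mem_image.1 (Finset.mem_coe.1 hp)
    obtain ⟨y, hy, rfl⟩ := Finset.mem_image.1 (Finset.mem_coe.1 hq)
    simp only [hsu x (hSa x hx), hsu y (hSa y hy)]
    have := h x hx y hy (sbtw_base_iff.2 ⟨by
      rw [hu x (hSa x hx), hu y (hSa y hy)]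
      exact WithTop.coe_lt_coe.2 hpq, hSa y hy⟩)
    rw [sbtw_base_iff, hu _ (hj x hx), hu _ (hj y hy)] at this
    exact WithTop.coe_lt_coe.1 this.1)
  refine ⟨ofRat a f, ofRat_smul_self a f, fun x hx => ?_⟩
  have h1 := ofRat_smul_symm_coe a f (u x)
  rw [hf _ (Finset.mem_image_of_mem u hx), hsu x (hSa x hx), hsu _ (hj x hx)] at h1
  exact h1

end CircularAut

/-! ### Polishness -/

section Polish

/-- The range of `g ↦ g` alone need not be closed, since a limit may fail to be surjective;
recording `g⁻¹` as well makes it closed. -/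
theorem circularAut.polishSpace : PolishSpace circularAut := by
  let i : TopologicalSpace RatCircle := ⊥
  have : DiscreteTopology RatCircle := ⟨rfl⟩
  have : Countable RatCircle := (AddCircle.equivIoc (1 : ℚ) 0).injective.countable
  have : IsTopologicalGroup circularAut := isTopologicalGroup_pointwise _ _
  have : PolishSpace RatCircle := inferInstance
  let Φ : circularAut → (RatCircle → RatCircle) × (RatCircle → RatCircle) :=
    fun g => (fun x => g • x, fun x => g⁻¹ • x)
  have hcont : Continuous fun (g : circularAut) (x : RatCircle) => g • x := continuous_induced_dom
  have hΦ : Continuous Φ := hcont.prodMk (hcont.comp continuous_inv)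
  have hind : IsInducing Φ := by
    refine ⟨le_antisymm hΦ.le_induced ?_⟩
    have h1 : (Prod.fst ∘ Φ) = fun (g : circularAut) (x : RatCircle) => g • x := rfl
    change _ ≤ TopologicalSpace.induced (fun (g : circularAut) (x : RatCircle) => g • x) _
    rw [← h1, ← induced_compose]
    exact induced_mono (continuous_iff_le_induced.1 continuous_fst)
  have hinj : Function.Injective Φ := fun g h e =>
    circularAut.ext_smul fun x => congrFun (congrArg Prod.fst e) x
  have hrange : Set.range Φ = {p | (∀ x, p.2 (p.1 x) = x) ∧ (∀ x, p.1 (p.2 x) = x) ∧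
      ∀ a b c, sbtw (p.1 a) (p.1 b) (p.1 c) ↔ sbtw a b c} := by
    ext p
    constructor
    · rintro ⟨g, rfl⟩
      exact ⟨fun x => inv_smul_smul g x, fun x => smul_inv_smul g x, g.2⟩
    · rintro ⟨h1, h2, h3⟩
      exact ⟨⟨⟨p.1, p.2, h1, h2⟩, h3⟩, rfl⟩
  have hev : ∀ x : RatCircle, Continuous fun p : (RatCircle → RatCircle) × (RatCircle → RatCircle) =>
      p.1 x := fun x => (continuous_apply x).comp continuous_fst
  have hev' : ∀ x : RatCircle, Continuous fun p : (RatCircle → RatCircle) × (RatCircle → RatCircle) =>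
      p.2 x := fun x => (continuous_apply x).comp continuous_snd
  have hcomp : ∀ x y : RatCircle,
      IsClosed {p : (RatCircle → RatCircle) × (RatCircle → RatCircle) | p.2 (p.1 x) = y} := by
    intro x y
    have : {p : (RatCircle → RatCircle) × (RatCircle → RatCircle) | p.2 (p.1 x) = y} =
        ⋂ z, {p | p.1 x = z → p.2 z = y} := by
      ext p
      simp
    rw [this]
    exact isClosed_iInter fun z => (isClosed_discrete
      {t : RatCircle × RatCircle | t.1 = z → t.2 = y}).preimage ((hev x).prodMk (hev' z))
  have hcomp' : ∀ x y : RatCircle,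
      IsClosed {p : (RatCircle → RatCircle) × (RatCircle → RatCircle) | p.1 (p.2 x) = y} := fun x y => (hcomp x y).preimage continuous_swap
  have hclosed : IsClosed (Set.range Φ) := by
    rw [hrange]
    simp only [Set.ofPred_and, Set.ofPred_forall]
    refine (isClosed_iInter fun x => hcomp x x).inter
      ((isClosed_iInter fun x => hcomp' x x).inter (isClosed_iInter fun a => isClosed_iInter fun b =>
        isClosed_iInter fun c => ?_))
    exact (isClosed_discrete {t : RatCircle × RatCircle × RatCircle |
      sbtw t.1 t.2.1 t.2.2 ↔ sbtw a b c}).preimage ((hev a).prodMk ((hev b).prodMk (hev c)))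
  exact (IsClosedEmbedding.mk ⟨hind, hinj⟩ hclosed).polishSpace

end Polish

/-! ### The arc topology, and failure of co-minimality -/

section ArcTopology

open RatCircle circularAut

/-- The topology of pointwise convergence on `circularAut` with respect to the order topology of
the rational circle. -/
abbrev circularAut.arcTopology : TopologicalSpace circularAut :=
  TopologicalSpace.generateFrom {U | ∃ p x q : RatCircle, U = {g | sbtw p (g • x) q}}

theorem circularAut.le_arcTopology_iff {σ : TopologicalSpace circularAut} :
    σ ≤ arcTopology ↔ ∀ p x q : RatCircle, IsOpen[σ] {g : circularAut | sbtw p (g • x) q} := by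
  rw [arcTopology, TopologicalSpace.le_generateFrom_iff_subset_isOpen]
  constructor
  · exact fun h p x q => h ⟨p, x, q, rfl⟩
  · rintro h _ ⟨p, x, q, rfl⟩
    exact h p x q

theorem circularAut.isOpen_sbtw_smul {σ : TopologicalSpace circularAut} (hσ : σ ≤ arcTopology)
    (p x q : RatCircle) : IsOpen[σ] {g : circularAut | sbtw p (g • x) q} :=
  le_arcTopology_iff.1 hσ p x q

theorem circularAut.isOpen_sbtw_smul_smul {σ : TopologicalSpace circularAut}
    (hσ : σ ≤ arcTopology) (a x y : RatCircle) :
    IsOpen[σ] {g : circularAut | sbtw a (g • x) (g • y)} := by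
  have : {g : circularAut | sbtw a (g • x) (g • y)} =
      ⋃ z, {g : circularAut | sbtw a (g • x) z} ∩ {g : circularAut | sbtw z (g • y) a} := by
    ext g
    simp only [Set.mem_ofPred_eq, Set.mem_iUnion, Set.mem_inter_iff]
    constructor
    · intro h
      obtain ⟨z, hz⟩ := exists_sbtw (sbtw_right_ne h)
      refine ⟨z, ?_⟩
      simp only [sbtw_iff_chart a] at *
      grind
    · rintro ⟨z, h1, h2⟩
      simp only [sbtw_iff_chart a] at *
      grind
  rw [this]
  exact isOpen_iUnion fun z => (isOpen_sbtw_smul hσ _ _ _).inter (isOpen_sbtw_smul hσ _ _ _)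

theorem circularAut.isOpen_smul_ne {σ : TopologicalSpace circularAut} (hσ : σ ≤ arcTopology)
    (x y : RatCircle) : IsOpen[σ] {g : circularAut | g • x ≠ y} := by
  have : {g : circularAut | g • x ≠ y} = ⋃ z, {g : circularAut | sbtw y (g • x) z} := by
    ext g
    simp only [Set.mem_ofPred_eq, Set.mem_iUnion]
    constructor
    · intro h
      obtain ⟨z, hz⟩ := exists_sbtw h
      exact ⟨z, sbtw_cyclic_right hz⟩
    · rintro ⟨z, hz⟩
      exact sbtw_left_ne hz
  rw [this]
  exact isOpen_iUnion fun z => isOpen_sbtw_smul hσ _ _ _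

theorem circularAut.pointwise_le_arcTopology : instTopologicalSpace ≤ arcTopology := by
  refine le_arcTopology_iff.2 fun p x q => ?_
  have : {g : circularAut | sbtw p (g • x) q} =
      ⋃ y ∈ {y | sbtw p y q}, {g : circularAut | g • x = y} := by
    ext g
    simp
  rw [this]
  exact isOpen_biUnion fun y _ => isOpen_pointwise_smul_eq circularAut x y

theorem circularAut.isTopologicalGroup_arcTopology :
    @IsTopologicalGroup circularAut arcTopology _ := by
  let σ : TopologicalSpace circularAut := arcTopology
  have hσ : σ ≤ arcTopology := le_rfl
  refine { continuous_mul := ?_, continuous_inv := ?_ }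
  · refine continuous_generateFrom_iff.2 ?_
    rintro _ ⟨p, x, q, rfl⟩
    -- An arc around `g • h • x` inside the given one is pulled back by `g`, which separates the
    -- conditions on `g` and `h`.
    have : (fun t : circularAut × circularAut => t.1 * t.2) ⁻¹' {g | sbtw p (g • x) q} =
        ⋃ r, ⋃ s, ({g : circularAut | sbtw p (g • r) (g • s)} ∩ {g | sbtw p (g • s) q}) ×ˢ
          {h : circularAut | sbtw r (h • x) s} := by
      ext ⟨g, h⟩
      simp only [Set.mem_preimage, Set.mem_ofPred_eq, Set.mem_iUnion, Set.mem_prod,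
        Set.mem_inter_iff, mul_smul]
      constructor
      · intro H
        obtain ⟨r, hr⟩ := exists_sbtw (sbtw_left_ne H).symm
        obtain ⟨s, hs⟩ := exists_sbtw (sbtw_right_ne H)
        refine ⟨g⁻¹ • r, g⁻¹ • s, ?_⟩
        rw [← sbtw_smul g (x := g⁻¹ • r), smul_inv_smul, smul_inv_smul]
        simp only [sbtw_iff_chart p] at *
        grind
      · rintro ⟨r, s, ⟨h1, h2⟩, h3⟩
        rw [← sbtw_smul g] at h3
        simp only [sbtw_iff_chart p] at *
        grind
    rw [this]
    exact isOpen_iUnion fun r => isOpen_iUnion fun s =>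
      ((isOpen_sbtw_smul_smul hσ _ _ _).inter (isOpen_sbtw_smul hσ _ _ _)).prod
        (isOpen_sbtw_smul hσ _ _ _)
  · refine continuous_generateFrom_iff.2 ?_
    rintro _ ⟨p, x, q, rfl⟩
    have : (fun g : circularAut => g⁻¹) ⁻¹' {g | sbtw p (g • x) q} =
        {g : circularAut | sbtw x (g • q) (g • p)} := by
      ext g
      simp only [Set.mem_preimage, Set.mem_ofPred_eq]
      rw [← sbtw_smul g, smul_inv_smul]
      exact ⟨sbtw_cyclic_left, sbtw_cyclic_right⟩
    rw [this]
    exact isOpen_sbtw_smul_smul hσ _ _ _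

theorem circularAut.t2Space_arcTopology : @T2Space circularAut arcTopology := by
  let σ : TopologicalSpace circularAut := arcTopology
  refine ⟨fun g h hne => ?_⟩
  obtain ⟨x, hx⟩ : ∃ x : RatCircle, g • x ≠ h • x := by
    by_contra! H
    exact hne (ext_smul H)
  obtain ⟨p, hp⟩ := exists_sbtw hx.symm
  obtain ⟨q, hq⟩ := exists_sbtw hx
  -- The points `p` and `q` separate `g • x` from `h • x` into complementary arcs.
  refine ⟨_, _, isOpen_sbtw_smul le_rfl p x q, isOpen_sbtw_smul le_rfl q x p, ?_, ?_, ?_⟩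
  · simp only [Set.mem_ofPred_eq, sbtw_iff_chart (g • x)] at *
    grind
  · simp only [Set.mem_ofPred_eq, sbtw_iff_chart (g • x)] at *
    grind
  · rw [Set.disjoint_left]
    intro k h1 h2
    simp only [Set.mem_ofPred_eq, sbtw_iff_chart p] at *
    grind

theorem circularAut.arcTopology_mem :
    arcTopology ∈ coarserHausdorffGroupTopologies circularAut :=
  ⟨isTopologicalGroup_arcTopology, t2Space_arcTopology, pointwise_le_arcTopology⟩

theorem circularAut.tendsto_ofRat_addRight (a : RatCircle) :
    Tendsto (fun n : ℕ => ofRat a (OrderIso.addRight (1 / ((n : ℚ) + 1)))) atTop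
      (@nhds circularAut arcTopology 1) := by
  refine TopologicalSpace.tendsto_nhds_generateFrom_iff.2 ?_
  rintro _ ⟨p, x, q, rfl⟩ h
  simp only [Set.mem_ofPred_eq, one_smul] at h
  have key : ∀ y z : RatCircle, chart a y < chart a z →
      ∀ᶠ n : ℕ in atTop,
        chart a (ofRat a (OrderIso.addRight (1 / ((n : ℚ) + 1))) • y) < chart a z := by
    intro y z hyz
    simp only [chart_ofRat_smul]
    generalize chart a y = Y at *
    generalize chart a z = Z at *
    induction Y with
    | top => exact absurd hyz not_top_lt
    | coe s =>
      induction Z with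
      | top => exact Eventually.of_forall fun n => WithTop.coe_lt_top _
      | coe t =>
        have hst : 0 < t - s := sub_pos.2 (WithTop.coe_lt_coe.1 hyz)
        obtain ⟨N, hN⟩ := exists_nat_one_div_lt hst
        filter_upwards [eventually_ge_atTop N] with n hn
        have h1 : (1 : ℚ) / (n + 1) ≤ 1 / (N + 1) := Nat.one_div_le_one_div hn
        refine WithTop.coe_lt_coe.2 ?_
        change s + 1 / ((n : ℚ) + 1) < t
        linarith
  -- Points only move upwards in the chart, so lower bounds persist and only strict upper bounds
  -- need large `n`.
  have hle : ∀ (n : ℕ) (y : RatCircle),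
      chart a y ≤ chart a (ofRat a (OrderIso.addRight (1 / ((n : ℚ) + 1))) • y) := by
    intro n y
    rw [chart_ofRat_smul]
    generalize chart a y = Y
    induction Y with
    | top => exact le_rfl
    | coe s =>
      refine WithTop.coe_le_coe.2 ?_
      change s ≤ s + 1 / ((n : ℚ) + 1)
      have : (0 : ℚ) < 1 / ((n : ℚ) + 1) := Nat.one_div_pos_of_nat
      linarith
  simp only [Set.preimage_ofPred_eq]
  rw [sbtw_iff_chart a] at h
  simp only [sbtw_iff_chart a]
  rcases h with ⟨h1, h2⟩ | ⟨h1, h2⟩ | ⟨h1, h2⟩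
  · filter_upwards [key x q h2] with n hn
    exact Or.inl ⟨h1.trans_le (hle n x), hn⟩
  · filter_upwards [key x q h1] with n hn
    exact Or.inr (Or.inl ⟨hn, h2⟩)
  · exact Eventually.of_forall fun n => Or.inr (Or.inr ⟨h1, h2.trans_le (hle n x)⟩)

theorem circularAut.exists_mem_nhds_arcTopology {a x : RatCircle} (hx : x ≠ a)
    {U : Set circularAut} (hU : U ∈ @nhds circularAut arcTopology 1) :
    ∃ g ∈ U, g • a = a ∧ g • x ≠ x := by
  obtain ⟨n, hn⟩ := ((tendsto_ofRat_addRight a).eventually hU).exists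
  refine ⟨_, hn, ofRat_smul_self _ _, fun h => ?_⟩
  have h1 := congrArg (chart a) h
  rw [chart_ofRat_smul] at h1
  obtain ⟨q, hq⟩ := WithTop.ne_top_iff_exists.1 fun h' => hx ((chart_eq_top (a := a)).1 h')
  rw [← hq] at h1
  have h2 : q + 1 / ((n : ℚ) + 1) = q := WithTop.coe_injective h1
  have : (0 : ℚ) < 1 / ((n : ℚ) + 1) := Nat.one_div_pos_of_nat
  linarith

theorem RatCircle.exists_ne_point (a : RatCircle) : ∃ x, x ≠ a :=
  ⟨_, chart_symm_coe_ne a 0⟩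

theorem circularAut.not_isCoMinimal_stabilizer (a : RatCircle) :
    ¬ IsCoMinimal (MulAction.stabilizer circularAut a) := by
  intro h
  have h1 := h _ arcTopology_mem
  let H := MulAction.stabilizer circularAut a
  have hpre : (QuotientGroup.mk : circularAut → circularAut ⧸ H) ⁻¹' {QuotientGroup.mk 1} =
      {g | g • a = a} := by
    ext g
    simp only [Set.mem_preimage, Set.mem_singleton_iff, Set.mem_ofPred_eq]
    rw [eq_comm, QuotientGroup.eq]
    simp [H, MulAction.mem_stabilizer_iff]
  have h2 : IsOpen[TopologicalSpace.coinduced (QuotientGroup.mk : circularAut → circularAut ⧸ H)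
      circularAut.instTopologicalSpace] {QuotientGroup.mk 1} := by
    rw [isOpen_coinduced, hpre]
    exact isOpen_pointwise_smul_eq circularAut a a
  rw [← h1, isOpen_coinduced, hpre] at h2
  obtain ⟨x, hx⟩ := exists_ne_point a
  -- The translations are based at `x`, so that they move `a`.
  obtain ⟨g, hg, -, hga⟩ := exists_mem_nhds_arcTopology hx.symm
    (@IsOpen.mem_nhds circularAut arcTopology 1 _ h2 (one_smul circularAut a))
  exact hga hg

end ArcTopology

/-! ### Classification of the coarser topologies, and inj-key -/

section ArcTopologyMinimal

open RatCircle circularAut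

/-- The automorphism of `ℚ` fixing `(-∞, c]` and expanding `[c, ∞)` from `c` by the factor `2`. -/
def Rat.stretch (c : ℚ) : ℚ ≃o ℚ where
  toFun t := if t ≤ c then t else 2 * t - c
  invFun t := if t ≤ c then t else (t + c) / 2
  left_inv t := by
    simp only
    split_ifs <;> linarith
  right_inv t := by
    simp only
    split_ifs <;> linarith
  map_rel_iff' := by
    intro s t
    simp only [Equiv.coe_fn_mk]
    split_ifs <;> constructor <;> intro <;> linarith

theorem Rat.stretch_apply (c t : ℚ) : Rat.stretch c t = if t ≤ c then t else 2 * t - c := rfl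

theorem circularAut.ofRat_stretch_smul {p q x : RatCircle} {c : ℚ} (hp : chart q p ≤ c)
    (hx : ¬ sbtw p x q) : ofRat q (Rat.stretch c) • x = x := by
  by_cases hxq : x = q
  · rw [hxq, ofRat_smul_self]
  · obtain ⟨t, ht⟩ := WithTop.ne_top_iff_exists.1 fun h' => hxq ((chart_eq_top (a := q)).1 h')
    have hle : chart q x ≤ chart q p := by
      by_contra! h
      exact hx (sbtw_cyclic_left (sbtw_base_iff.2 ⟨h, hxq⟩))
    have htc : t ≤ c := WithTop.coe_le_coe.1 (by rw [ht]; exact hle.trans hp)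
    have hxt : x = (chart q).symm t := by rw [ht]; simp
    rw [hxt, ofRat_smul_symm_coe, Rat.stretch_apply, if_pos htc]

/-- With `P` the coordinate of `p` in the chart at `q`, the stretches from `P` and `P + 1` send `P +
1` to `P + 2` or `P + 3`, according to their order. -/
theorem circularAut.exists_not_commute_of_ne {p q : RatCircle} (hpq : p ≠ q) :
    ∃ f h : circularAut, (∀ x, ¬ sbtw p x q → f • x = x) ∧ (∀ x, ¬ sbtw p x q → h • x = x) ∧
      ¬ Commute f h := by
  obtain ⟨P, hP⟩ := WithTop.ne_top_iff_exists.1 fun h' => hpq ((chart_eq_top (a := q)).1 h')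
  refine ⟨ofRat q (Rat.stretch P), ofRat q (Rat.stretch (P + 1)),
    fun x => ofRat_stretch_smul hP.ge, fun x => ofRat_stretch_smul (hP.ge.trans ?_), fun hc => ?_⟩
  · exact WithTop.coe_le_coe.2 (by linarith)
  · have h1 := congrArg (fun g : circularAut => g • (chart q).symm ((P + 1 : ℚ) : WithTop ℚ)) hc.eq
    simp only [mul_smul, ofRat_smul_symm_coe, Rat.stretch_apply] at h1
    have h2 := WithTop.coe_injective ((chart q).symm.injective h1)
    grind

/-- If `A` and `B` are disjoint finite sets, the product of their pointwise stabilizers is a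
neighbourhood of the identity in the topology of pointwise convergence in the circle. -/
theorem circularAut.exists_mul_of_disjoint {A B : Finset RatCircle} {a : RatCircle} (ha : a ∈ B)
    (hAB : Disjoint A B) :
    {h : circularAut | ∃ k l : circularAut, (∀ x ∈ B, k • x = x) ∧ (∀ x ∈ A, l • x = x) ∧
      h = k * l} ∈ @nhds circularAut arcTopology 1 := by
  classical
  let τ : TopologicalSpace circularAut := arcTopology
  -- For `h` near 1 this map still preserves the order on `A ∪ B`; an extension `k` of it fixes `B`
  -- and agrees with `h` on `A`.
  let j : circularAut → RatCircle → RatCircle := fun h x => if x ∈ A then h • x else x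
  let S := (A ∪ B).erase a
  have haA : a ∉ A := fun h => Finset.disjoint_left.1 hAB h ha
  have hj1 : ∀ x, j 1 x = x := fun x => by simp [j]
  have hopen : ∀ x y, IsOpen[τ] {h : circularAut | sbtw a (j h x) (j h y)} := by
    intro x y
    by_cases hx : x ∈ A <;> by_cases hy : y ∈ A <;> simp only [j, hx, hy, if_true, if_false]
    · exact isOpen_sbtw_smul_smul le_rfl a x y
    · exact isOpen_sbtw_smul le_rfl a x y
    · have : {h : circularAut | sbtw a x (h • y)} = {h : circularAut | sbtw x (h • y) a} := by
        ext h
        exact (sbtw_cyclic (a := a) (b := x) (c := h • y)).trans sbtw_cyclic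
      rw [this]
      exact isOpen_sbtw_smul le_rfl x y a
    · exact isOpen_const
  have h1 : ∀ᶠ h in @nhds _ τ 1, ∀ x ∈ S, ∀ y ∈ S, sbtw a x y → sbtw a (j h x) (j h y) := by
    refine (Filter.eventually_all_finset S).2 fun x _ => (Filter.eventually_all_finset S).2
      fun y _ => ?_
    by_cases hxy : sbtw a x y
    · filter_upwards [(hopen x y).mem_nhds (by simpa [hj1] using hxy)] with h hh _ using hh
    · exact Eventually.of_forall fun h h' => absurd h' hxy
  have h2 : ∀ᶠ h : circularAut in @nhds _ τ 1, ∀ x ∈ A, h • x ≠ a := by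
    refine (Filter.eventually_all_finset A).2 fun x hx => ?_
    refine (isOpen_smul_ne le_rfl x a).mem_nhds ?_
    simp only [Set.mem_ofPred_eq, one_smul]
    exact fun h => haA (h ▸ hx)
  filter_upwards [h1, h2] with h hh1 hh2
  obtain ⟨k, hka, hk⟩ := exists_eqOn_of_sbtw S (j h) (Finset.notMem_erase _ _) (by
    intro x hx
    by_cases hxA : x ∈ A
    · simpa [j, hxA] using hh2 x hxA
    · simpa [j, hxA] using (Finset.mem_erase.1 hx).1) hh1
  refine ⟨k, k⁻¹ * h, fun x hx => ?_, fun x hx => ?_, by simp⟩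
  · by_cases hxa : x = a
    · rw [hxa, hka]
    · have hxA : x ∉ A := fun h' => Finset.disjoint_left.1 hAB h' hx
      rw [hk x (Finset.mem_erase.2 ⟨hxa, Finset.mem_union_right _ hx⟩)]
      simp [j, hxA]
  · rw [mul_smul, inv_smul_eq_iff,
      hk x (Finset.mem_erase.2 ⟨fun h' => haA (h' ▸ hx), Finset.mem_union_left _ hx⟩)]
    simp [j, hx]

section

variable [σ : TopologicalSpace circularAut] [IsTopologicalGroup circularAut]

/-- Take non-commuting `f` and `h` supported in the arc. Not commuting with `h` is an open condition
on `g * f * g⁻¹`, true at `g = 1`; it fails once `g` moves the arc off itself, as the supports are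
then disjoint. -/
theorem circularAut.arc_meets_mem_nhds_one [T2Space circularAut] {p q : RatCircle} (hpq : p ≠ q) :
    {g : circularAut | ∃ c, sbtw p c q ∧ sbtw p (g • c) q} ∈ 𝓝 (1 : circularAut) := by
  obtain ⟨f, h, hf, hh, hfh⟩ := exists_not_commute_of_ne hpq
  have hopen : IsOpen {g : circularAut | g * f * g⁻¹ * h ≠ h * (g * f * g⁻¹)} :=
    isOpen_ne_fun (by fun_prop) (by fun_prop)
  refine mem_of_superset (hopen.mem_nhds (by simpa [Commute, SemiconjBy] using hfh)) fun g hg => ?_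
  by_contra hcon
  refine hg (ext_smul fun x => ?_)
  have hd : Equiv.Perm.Disjoint (g * f * g⁻¹ : circularAut).1 h.1 := by
    intro y
    by_cases hy : sbtw p y q
    · left
      have : f • (g⁻¹ • y) = g⁻¹ • y := hf _ fun h' => hcon ⟨g⁻¹ • y, h', by rwa [smul_inv_smul]⟩
      change (g * f * g⁻¹) • y = y
      rw [mul_smul, mul_smul, this, smul_inv_smul]
    · exact Or.inr (hh y hy)
  exact congrArg (fun k : Equiv.Perm RatCircle => k x) hd.commute.eq

/-- The topology of pointwise convergence in the circle is the coarsest Hausdorff group topology. -/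
theorem circularAut.le_arcTopology [T2Space circularAut] : σ ≤ arcTopology := by
  refine le_arcTopology_iff.2 fun p x q => isOpen_iff_mem_nhds.2 fun g hg => ?_
  have hg' : sbtw (g⁻¹ • p) x (g⁻¹ • q) := by
    rw [← sbtw_smul g, smul_inv_smul, smul_inv_smul]
    exact hg
  have hN := inter_mem (arc_meets_mem_nhds_one (sbtw_left_ne hg').symm)
    (arc_meets_mem_nhds_one (sbtw_right_ne hg'))
  have ht : Tendsto (fun k : circularAut => g⁻¹ * k) (𝓝 g) (𝓝 1) := by
    have := (continuous_const_mul g⁻¹).tendsto g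
    rwa [inv_mul_cancel] at this
  filter_upwards [ht hN] with k hk
  obtain ⟨⟨c, hc1, hc2⟩, d, hd1, hd2⟩ := hk
  -- The images of `c` and `d` stay on their sides of `x` and enclose the image of `x`.
  have hcd : sbtw c x d := by
    simp only [sbtw_iff_chart (g⁻¹ • p)] at *
    grind
  have hcd' := (sbtw_smul (g⁻¹ * k)).2 hcd
  have : sbtw (g⁻¹ • p) ((g⁻¹ * k) • x) (g⁻¹ • q) := by
    simp only [sbtw_iff_chart (g⁻¹ • p)] at *
    grind
  rwa [mul_smul, sbtw_smul] at this

theorem circularAut.dense_smul_ne [T2Space circularAut]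
    (h : ∀ x : RatCircle, ∀ V ∈ 𝓝 (1 : circularAut), ∃ v ∈ V, v • x ≠ x) (x y : RatCircle) :
    Dense {g : circularAut | g • x ≠ y} := by
  intro g
  rw [mem_closure_iff_nhds]
  intro W hW
  by_cases hg : g • x = y
  · have ht : Tendsto (fun k : circularAut => g * k) (𝓝 1) (𝓝 g) := by
      have := (continuous_const_mul g).tendsto 1
      rwa [mul_one] at this
    obtain ⟨v, hv, hvx⟩ := h x _ (ht hW)
    refine ⟨g * v, hv, fun h' => hvx ?_⟩
    rw [mul_smul, ← hg] at h'
    exact smul_left_cancel g h'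
  · exact ⟨g, mem_of_mem_nhds hW, hg⟩

/-- Each condition `g • x ≠ y` defines a dense set, open because `σ` refines `arcTopology`; finitely
many such sets have dense intersection. -/
theorem circularAut.exists_mem_forall_smul_notMem [T2Space circularAut]
    (h : ∀ x : RatCircle, ∀ V ∈ 𝓝 (1 : circularAut), ∃ v ∈ V, v • x ≠ x)
    (F : Finset RatCircle) {V : Set circularAut} (hV : V ∈ 𝓝 1) :
    ∃ v ∈ V, ∀ x ∈ F, v • x ∉ F := by
  classical
  have key : ∀ P : Finset (RatCircle × RatCircle),
      IsOpen {g : circularAut | ∀ z ∈ P, g • z.1 ≠ z.2} ∧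
        Dense {g : circularAut | ∀ z ∈ P, g • z.1 ≠ z.2} := by
    intro P
    induction P using Finset.induction_on with
    | empty => simp
    | insert z P _ ih =>
      have : {g : circularAut | ∀ w ∈ insert z P, g • w.1 ≠ w.2} =
          {g | g • z.1 ≠ z.2} ∩ {g : circularAut | ∀ w ∈ P, g • w.1 ≠ w.2} := by
        ext g
        simp
      rw [this]
      have ho := isOpen_smul_ne le_arcTopology z.1 z.2
      exact ⟨ho.inter ih.1, (dense_smul_ne h z.1 z.2).inter_of_isOpen_left ih.2 ho⟩
  obtain ⟨v, hvV, hv⟩ := mem_closure_iff_nhds.1 ((key (F ×ˢ F)).2 1) V hV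
  exact ⟨v, hvV, fun x hx hvx => hv (x, v • x) (Finset.mk_mem_product hx hvx) rfl⟩

/-- Let `V` contain the pointwise stabilizer of `F`, and let `v ∈ V` move `F` off itself. The
stabilizer of `v • F` is the conjugate by `v` of that of `F`, so the product of the two lies in `V *
V * V⁻¹ * V`, while it is an `arcTopology`-neighbourhood of 1. -/
theorem circularAut.eq_arcTopology_of_stabilizer_notMem_nhds [T2Space circularAut]
    (hle : instTopologicalSpace ≤ σ)
    (h : ∀ x : RatCircle, ∀ V ∈ 𝓝 (1 : circularAut), ∃ v ∈ V, v • x ≠ x) : σ = arcTopology := by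
  classical
  refine IsTopologicalGroup.ext inferInstance isTopologicalGroup_arcTopology
    (le_antisymm (nhds_mono le_arcTopology) ?_)
  intro U hU
  have hc : Continuous fun t : circularAut × circularAut × circularAut =>
      t.1 * t.2.1 * t.1⁻¹ * t.2.2 := by fun_prop
  have hU' := hc.tendsto (1, 1, 1) (by simpa using hU)
  obtain ⟨V, hV, hVU⟩ : ∃ V ∈ 𝓝 (1 : circularAut), ∀ v ∈ V, ∀ k ∈ V, ∀ l ∈ V,
      v * k * v⁻¹ * l ∈ U := by
    obtain ⟨V₁, hV₁, W, hW, hVW⟩ := mem_nhds_prod_iff.1 hU'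
    obtain ⟨V₂, hV₂, V₃, hV₃, hVV⟩ := mem_nhds_prod_iff.1 hW
    exact ⟨V₁ ∩ (V₂ ∩ V₃), inter_mem hV₁ (inter_mem hV₂ hV₃), fun v hv k hk l hl =>
      hVW (show (v, k, l) ∈ V₁ ×ˢ W from ⟨hv.1, hVV ⟨hk.2.1, hl.2.2⟩⟩)⟩
  obtain ⟨F₀, hF₀⟩ := exists_finset_of_mem_nhds_one_pointwise (nhds_mono hle hV)
  -- The extra point makes `F` nonempty, so that its translate supplies a cut point.
  let F := insert (0 : RatCircle) F₀
  have hF : ∀ g : circularAut, (∀ x ∈ F, g • x = x) → g ∈ V := fun g hg =>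
    hF₀ g fun x hx => hg x (Finset.mem_insert_of_mem hx)
  obtain ⟨v, hvV, hv⟩ := exists_mem_forall_smul_notMem h F hV
  have hdisj : Disjoint F (F.image fun x => v • x) := by
    rw [Finset.disjoint_right]
    intro y hy
    obtain ⟨x, hx, rfl⟩ := Finset.mem_image.1 hy
    exact hv x hx
  filter_upwards [exists_mul_of_disjoint
    (Finset.mem_image_of_mem (fun x => v • x) (Finset.mem_insert_self (0 : RatCircle) F₀)) hdisj]
    with g hg
  obtain ⟨k, l, hk, hl, rfl⟩ := hg
  have hkv : v⁻¹ * k * v ∈ V := hF _ fun x hx => by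
    rw [mul_smul, mul_smul, hk _ (Finset.mem_image_of_mem _ hx), inv_smul_smul]
  have := hVU v hvV _ hkv l (hF l hl)
  simpa [mul_assoc] using this

/-- The pointwise topology and the topology of pointwise convergence in the circle are the only
Hausdorff group topologies coarser than the pointwise topology. -/
theorem circularAut.eq_pointwise_or_eq_arcTopology [T2Space circularAut]
    (hle : instTopologicalSpace ≤ σ) : σ = instTopologicalSpace ∨ σ = arcTopology := by
  by_cases h : ∀ x : RatCircle, ∀ V ∈ 𝓝 (1 : circularAut), ∃ v ∈ V, v • x ≠ x
  · exact Or.inr (eq_arcTopology_of_stabilizer_notMem_nhds hle h)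
  · left
    push Not at h
    obtain ⟨x, V, hV, hVx⟩ := h
    refine IsTopologicalGroup.ext inferInstance (isTopologicalGroup_pointwise _ _)
      (le_antisymm (fun U hU => ?_) (nhds_mono hle))
    obtain ⟨F, hF⟩ := exists_finset_of_mem_nhds_one_pointwise hU
    -- By transitivity, the stabilizer of `y` is conjugate to that of `x`.
    have hy : ∀ y ∈ F, ∀ᶠ g : circularAut in 𝓝 1, g • y = y := fun y _ => by
      obtain ⟨k, rfl⟩ := exists_smul_eq x y
      have hk : Continuous fun g : circularAut => k⁻¹ * g * k := by fun_prop
      filter_upwards [hk.tendsto 1 (by simpa using hV)] with g hg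
      have := hVx _ hg
      rwa [mul_smul, mul_smul, inv_smul_eq_iff] at this
    filter_upwards [(Filter.eventually_all_finset F).2 hy] with g hg using hF g hg

end

theorem circularAut.isInjKey_stabilizer (a : RatCircle) :
    IsInjKey (MulAction.stabilizer circularAut a) := by
  have hne : TopologicalSpace.induced (Subtype.val : MulAction.stabilizer circularAut a → _)
      instTopologicalSpace ≠ TopologicalSpace.induced Subtype.val arcTopology := by
    intro heq
    obtain ⟨x, hx⟩ := exists_ne_point a
    have h1 : IsOpen[TopologicalSpace.induced (Subtype.val : MulAction.stabilizer circularAut a → _)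
        instTopologicalSpace] (Subtype.val ⁻¹' {g : circularAut | g • x = x}) :=
      ⟨_, isOpen_pointwise_smul_eq circularAut x x, rfl⟩
    rw [heq] at h1
    obtain ⟨U, hU, hUx⟩ := h1
    have h1U : (1 : circularAut) ∈ U := by
      have : (1 : MulAction.stabilizer circularAut a) ∈ Subtype.val ⁻¹' U := by
        rw [hUx]
        exact one_smul circularAut x
      exact this
    obtain ⟨g, hgU, hga, hgx⟩ := exists_mem_nhds_arcTopology hx
      (@IsOpen.mem_nhds circularAut arcTopology 1 _ hU h1U)
    have : (⟨g, hga⟩ : MulAction.stabilizer circularAut a) ∈ Subtype.val ⁻¹' U := hgU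
    rw [hUx] at this
    exact hgx this
  rintro σ₁ ⟨hg₁, ht₁, hle₁⟩ σ₂ ⟨hg₂, ht₂, hle₂⟩ heq
  simp only at heq
  rcases @eq_pointwise_or_eq_arcTopology σ₁ hg₁ ht₁ hle₁ with h₁ | h₁ <;>
    rcases @eq_pointwise_or_eq_arcTopology σ₂ hg₂ ht₂ hle₂ with h₂ | h₂
  · rw [h₁, h₂]
  · rw [h₁, h₂] at heq
    exact absurd heq hne
  · rw [h₁, h₂] at heq
    exact absurd heq.symm hne
  · rw [h₁, h₂]

end ArcTopologyMinimal

theorem theorem3p1 :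
    IsTopologicalGroup circularAut ∧ PolishSpace circularAut ∧
    IsExtremelyAmenable.{0, v} (ℚ ≃o ℚ) ∧
    ∀ a₀ : RatCircle,
      Nonempty (MulAction.stabilizer circularAut a₀ ≃ₜ* (ℚ ≃o ℚ)) ∧
      IsInjKey (MulAction.stabilizer circularAut a₀) ∧
      ¬ IsCoMinimal (MulAction.stabilizer circularAut a₀) :=
  ⟨isTopologicalGroup_pointwise _ _, circularAut.polishSpace, ratOrderAut_isExtremelyAmenable,
    fun a => ⟨⟨circularAut.stabilizerEquiv a⟩, circularAut.isInjKey_stabilizer a,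
      circularAut.not_isCoMinimal_stabilizer a⟩⟩
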